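/- Let $m\ge 1$ and let $\mathbf{y}=\mathbf{G}(x,\mathbf{y})$, with $\mathbf{y}=(y_1,\ldots,y_m)$ and $\mathbf{G}=(G_1,\ldots,G_m)$, be a system of equations whose right-hand sides $G_i(x,\mathbf{y})$ are formal power series with real coefficients. Write $J_{\mathbf G}=(\partial G_i/\partial y_j)$ for the matrix of formal partial derivatives. The system is called \emph{well-conditioned} if: (a) each $G_i$ has nonnegative coefficients; (b) $\mathbf{G}$ is holomorphic in a neighborhood of the origin; (c) $\mathbf{G}(0,\mathbf{y})=\mathbf{0}$; (d) $G_i(x,\mathbf{0})\neq 0$ for all $i$; (e) $\det(I-J_{\mathbf G}(0,\mathbf{0}))\neq 0$; (f) $J_{\mathbf G}$ is irreducible, that is, the directed graph on $\{1,\ldots,m\}$ with an edge from $i$ to $j$ whenever $\partial G_i/\partial y_j\neq 0$ is strongly connected; (g) $\partial^2 G_i/\partial y_j\partial y_k\neq 0$ for some $i,j,k$. A well-conditioned system has a \emph{standard solution}, namely the unique vector $\mathbf{T}(x)=(T_1(x),\ldots,T_m(x))$ of formal power series with nonnegative coefficients and zero constant terms such that $\mathbf{T}(x)=\mathbf{G}(x,\mathbf{T}(x))$.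 All $T_i$ have the same radius of convergence $\rho\in(0,\infty)$ and converge at $\rho$; the point $(\rho,\boldsymbol{\tau})$ with $\tau_i=T_i(\rho)$ is the \emph{extreme point} of the system. A \emph{characteristic point} is a point $(a,\mathbf{b})\in\mathbb{R}^{m+1}$ with $a,b_1,\ldots,b_m>0$ such that all the series $G_i$ and $\partial G_i/\partial y_j$ converge at $(a,\mathbf{b})$, $b_i=G_i(a,\mathbf{b})$ for all $i$, and $\det(I-J_{\mathbf G}(a,\mathbf{b}))=0$. Let $\mathcal{CP}$ be the set of characteristic points. **Proposition.** Suppose the extreme point $(\rho,\boldsymbol{\tau})$ of a well-conditioned system $\mathbf{y}=\mathbf{G}(x,\mathbf{y})$ is a characteristic point of the system. Then: (a) $\rho$ is the largest first coordinate of any characteristic point, that is, $\rho=\max\{a:(a,\mathbf{b})\in\mathcal{CP}\}$; (b) $(\rho,\boldsymbol{\tau})$ is the only characteristic point whose first coordinate is $\rho$. -/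

import Mathlib

open scoped Topology ENNReal

noncomputable section

namespace CharSystem

/-- The `n`-th term (coefficient times monomial) of the real power series `A`, evaluated at the
real point `c`. -/
def summand {σ : Type*} (A : MvPowerSeries σ ℝ) (c : σ → ℝ) (n : σ →₀ ℕ) : ℝ :=
  MvPowerSeries.coeff n A * n.prod fun k e => c k ^ e

/-- The same term, evaluated at the complex point `z`. -/
def summandC {σ : Type*} (A : MvPowerSeries σ ℝ) (z : σ → ℂ) (n : σ →₀ ℕ) : ℂ :=
  ((MvPowerSeries.coeff n A : ℝ) : ℂ) * n.prod fun k e => z k ^ e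

/-- `A(c) = v`: the power series `A` converges at the point `c`, with the finite value `v`. -/
def HasValue {σ : Type*} (A : MvPowerSeries σ ℝ) (c : σ → ℝ) (v : ℝ) : Prop :=
  HasSum (summand A c) v

/-- The formal power series obtained from `A` by setting the variables in `s` equal to zero. -/
def setZero {σ : Type*} (s : Set σ) (A : MvPowerSeries σ ℝ) : MvPowerSeries σ ℝ :=
  Set.indicator {n : σ →₀ ℕ | ∀ k ∈ s, n k = 0} fun n => MvPowerSeries.coeff n A

/-- A system `y = G(x, y)` of `m` equations. The variables of each `G i` are indexed by
`Fin (m + 1)`: index `0` is `x`, and index `j.succ` is `y_j`. -/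
abbrev System (m : ℕ) := Fin m → MvPowerSeries (Fin (m + 1)) ℝ

/-- The Jacobian matrix `(∂G_i/∂y_j)` of formal power series. -/
def jacobian {m : ℕ} (G : System m) :
    Matrix (Fin m) (Fin m) (MvPowerSeries (Fin (m + 1)) ℝ) :=
  Matrix.of fun i j => MvPowerSeries.pderiv ℝ j.succ (G i)

/-- A square matrix is irreducible if the directed graph with an edge `i → j` for every
nonzero entry `M i j` is strongly connected. -/
def IrreducibleMatrix {ι R : Type*} [Zero R] (M : Matrix ι ι R) : Prop :=
  ∀ i j, Relation.ReflTransGen (fun k l => M k l ≠ 0) i j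

/-- Well-conditioned systems. -/
structure WellConditioned {m : ℕ} (G : System m) : Prop where
  /-- The coefficients are nonnegative. -/
  nonneg : ∀ i n, 0 ≤ MvPowerSeries.coeff n (G i)
  /-- `G` is holomorphic in a neighborhood of the origin. -/
  holomorphic : ∃ U : Set (Fin (m + 1) → ℂ), IsOpen U ∧ 0 ∈ U ∧ ∀ i,
    (∀ z ∈ U, Summable (summandC (G i) z)) ∧
    DifferentiableOn ℂ (fun z => ∑' n, summandC (G i) z n) U
  /-- `G(0, y) = 0`. -/
  x_zero : ∀ i, setZero {0} (G i) = 0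
  /-- `G_i(x, 0) ≠ 0` for all `i`. -/
  y_zero : ∀ i, setZero (Set.range Fin.succ) (G i) ≠ 0
  /-- `det (I - J_G(0, 0)) ≠ 0`. -/
  det_ne_zero : (1 - (jacobian G).map MvPowerSeries.constantCoeff).det ≠ 0
  /-- The Jacobian matrix is irreducible. -/
  irreducible : IrreducibleMatrix (jacobian G)
  /-- The system is nonlinear in `y`. -/
  nonlinear : ∃ i j k : Fin m,
    MvPowerSeries.pderiv ℝ j.succ (MvPowerSeries.pderiv ℝ k.succ (G i)) ≠ 0

/-- `T` is the standard solution of the system: a vector of formal power series in `x` with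
nonnegative coefficients (and constant term zero, so that the composition makes sense) that
satisfies `T(x) = G(x, T(x))` formally. -/
structure IsStandardSolution {m : ℕ} (G : System m) (T : Fin m → PowerSeries ℝ) : Prop where
  nonneg : ∀ i n, 0 ≤ PowerSeries.coeff n (T i)
  constantCoeff : ∀ i, PowerSeries.constantCoeff (T i) = 0
  eq_subst : ∀ i, T i =
    MvPowerSeries.subst (Fin.cons PowerSeries.X T : Fin (m + 1) → PowerSeries ℝ) (G i)

/-- The radius of convergence of a power series in one variable. -/
def radius (A : PowerSeries ℝ) : ℝ≥0∞ :=
  (FormalMultilinearSeries.ofScalars ℝ fun n => PowerSeries.coeff n A).radius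

/-- `(ρ, τ)` is the extreme point of the system: `ρ` is the (common) radius of convergence of the
components `T_i` of the standard solution, and `τ_i = T_i(ρ)`. -/
def IsExtremePoint {m : ℕ} (G : System m) (ρ : ℝ) (τ : Fin m → ℝ) : Prop :=
  0 ≤ ρ ∧ ∃ T : Fin m → PowerSeries ℝ, IsStandardSolution G T ∧
    ∀ i, radius (T i) = ENNReal.ofReal ρ ∧
      HasSum (fun n => PowerSeries.coeff n (T i) * ρ ^ n) (τ i)

/-- `(a, b)` is a characteristic point of the system: a positive solution of `y = G(x, y)`,
`det (I - J_G(x, y)) = 0`, where `J_G(a, b)` is the (finite) value of the formal Jacobian. -/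
def IsCharacteristicPoint {m : ℕ} (G : System m) (a : ℝ) (b : Fin m → ℝ) : Prop :=
  0 < a ∧ (∀ i, 0 < b i) ∧
    (∀ i, HasValue (G i) (Fin.cons a b : Fin (m + 1) → ℝ) (b i)) ∧
    ∃ J : Matrix (Fin m) (Fin m) ℝ,
      (∀ i j, HasValue (jacobian G i j) (Fin.cons a b : Fin (m + 1) → ℝ) (J i j)) ∧
      (1 - J).det = 0

end CharSystem

end

namespace CharSystem

/-! Two independent facts suffice. Domination: if `b = G(a, b)` with `a, b ≥ 0`, then every
truncation of `T` at `a` is at most `b`. Since `G(0, y) = 0`, each monomial of `G` contains `x`, so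
the terms of `T = G(x, T)` of degree at most `N` involve only those of `T` below `N`, and induction
applies (`IsStandardSolution.truncBoundedBy`). Hence `T` converges up to `a`, so `a ≤ ρ`; and if `a
= ρ`, letting the truncations grow gives `τ ≤ b`. Rigidity (`IsCharacteristicPoint.eq_of_le`): for
`b ≥ τ`, convexity gives `J (b - τ) ≤ b - τ`, where `J` is the Jacobian at `(ρ, τ)`. As `J` is
nonnegative, irreducible and has eigenvalue `1`, a Perron–Frobenius argument makes a nonzero `b - τ`
positive and fixed by `J`. But a nonlinear term makes one of the inequalities strict, so `b = τ`. -/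

/-! ### Truncated evaluation -/

/-- The value at `a` of the truncation of `P` to degree less than `N`. -/
noncomputable def truncValue (P : PowerSeries ℝ) (a : ℝ) (N : ℕ) : ℝ :=
  ∑ n ∈ Finset.range N, PowerSeries.coeff n P * a ^ n

/-- `P` has nonnegative coefficients and its truncation at degree `N` has value at most `v`
at `a`. -/
def TruncBoundedBy (a : ℝ) (N : ℕ) (P : PowerSeries ℝ) (v : ℝ) : Prop :=
  (∀ n, 0 ≤ PowerSeries.coeff n P) ∧ truncValue P a N ≤ v

lemma truncValue_nonneg {P : PowerSeries ℝ} (hP : ∀ n, 0 ≤ PowerSeries.coeff n P) {a : ℝ}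
    (ha : 0 ≤ a) (N : ℕ) : 0 ≤ truncValue P a N :=
  Finset.sum_nonneg fun n _ => mul_nonneg (hP n) (pow_nonneg ha n)

lemma coeff_mul_nonneg {P Q : PowerSeries ℝ} (hP : ∀ n, 0 ≤ PowerSeries.coeff n P)
    (hQ : ∀ n, 0 ≤ PowerSeries.coeff n Q) (n : ℕ) : 0 ≤ PowerSeries.coeff n (P * Q) := by
  rw [PowerSeries.coeff_mul]
  exact Finset.sum_nonneg fun p _ => mul_nonneg (hP _) (hQ _)

/-- The product of the truncations contains every term of total degree below `N`, and its other
terms are nonnegative. -/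
lemma truncValue_mul_le {P Q : PowerSeries ℝ} (hP : ∀ n, 0 ≤ PowerSeries.coeff n P)
    (hQ : ∀ n, 0 ≤ PowerSeries.coeff n Q) {a : ℝ} (ha : 0 ≤ a) (N : ℕ) :
    truncValue (P * Q) a N ≤ truncValue P a N * truncValue Q a N := by
  set f : ℕ × ℕ → ℝ := fun p =>
    (PowerSeries.coeff p.1 P * a ^ p.1) * (PowerSeries.coeff p.2 Q * a ^ p.2) with hf
  have hf0 : ∀ p, 0 ≤ f p := fun p =>
    mul_nonneg (mul_nonneg (hP _) (pow_nonneg ha _)) (mul_nonneg (hQ _) (pow_nonneg ha _))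
  have hR : truncValue P a N * truncValue Q a N =
      ∑ p ∈ Finset.range N ×ˢ Finset.range N, f p := by
    rw [truncValue, truncValue, Finset.sum_mul_sum, Finset.sum_product]
  have hL : truncValue (P * Q) a N = ∑ n ∈ Finset.range N,
      ∑ p ∈ Finset.range N ×ˢ Finset.range N with p.1 + p.2 = n, f p := by
    refine Finset.sum_congr rfl fun n hn => ?_
    rw [PowerSeries.coeff_mul, Finset.sum_mul]
    refine Finset.sum_congr ?_ fun p hp => ?_
    · ext p
      rw [Finset.HasAntidiagonal.mem_antidiagonal]
      simp only [Finset.mem_filter, Finset.mem_product,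
        Finset.mem_range] at hn ⊢
      omega
    · have h : p.1 + p.2 = n := (Finset.mem_filter.1 hp).2
      rw [hf, ← h, pow_add]
      ring
  rw [hR, hL]
  exact Finset.sum_fiberwise_le_sum_of_sum_fiber_nonneg fun n _ =>
    Finset.sum_nonneg fun p _ => hf0 p

lemma TruncBoundedBy.one (a : ℝ) (N : ℕ) : TruncBoundedBy a N 1 1 := by
  refine ⟨fun n => ?_, ?_⟩
  · rw [PowerSeries.coeff_one]
    split_ifs <;> norm_num
  · simp only [truncValue, PowerSeries.coeff_one, ite_mul, one_mul, zero_mul,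
      Finset.sum_ite_eq', Finset.mem_range]
    split_ifs <;> simp

lemma TruncBoundedBy.X {a : ℝ} (ha : 0 ≤ a) (N : ℕ) :
    TruncBoundedBy a N PowerSeries.X a := by
  refine ⟨fun n => ?_, ?_⟩
  · rw [PowerSeries.coeff_X]
    split_ifs <;> norm_num
  · simp only [truncValue, PowerSeries.coeff_X, ite_mul, one_mul, zero_mul,
      Finset.sum_ite_eq', Finset.mem_range]
    split_ifs <;> simp [ha]

lemma TruncBoundedBy.mul {a : ℝ} (ha : 0 ≤ a) {N : ℕ} {P Q : PowerSeries ℝ} {v w : ℝ}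
    (hP : TruncBoundedBy a N P v) (hQ : TruncBoundedBy a N Q w) :
    TruncBoundedBy a N (P * Q) (v * w) :=
  ⟨coeff_mul_nonneg hP.1 hQ.1, (truncValue_mul_le hP.1 hQ.1 ha N).trans
    (mul_le_mul hP.2 hQ.2 (truncValue_nonneg hQ.1 ha N)
      ((truncValue_nonneg hP.1 ha N).trans hP.2))⟩

lemma TruncBoundedBy.pow {a : ℝ} (ha : 0 ≤ a) {N : ℕ} {P : PowerSeries ℝ} {v : ℝ}
    (hP : TruncBoundedBy a N P v) (e : ℕ) : TruncBoundedBy a N (P ^ e) (v ^ e) := by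
  induction e with
  | zero => simpa using TruncBoundedBy.one a N
  | succ e ih => simpa only [pow_succ] using ih.mul ha hP

lemma TruncBoundedBy.prod {ι : Type*} {a : ℝ} (ha : 0 ≤ a) {N : ℕ} {P : ι → PowerSeries ℝ}
    {v : ι → ℝ} (s : Finset ι) (hP : ∀ i, TruncBoundedBy a N (P i) (v i)) :
    TruncBoundedBy a N (∏ i ∈ s, P i) (∏ i ∈ s, v i) :=
  Finset.prod_hom_rel (TruncBoundedBy.one a N) fun i _ _ h => (hP i).mul ha h

/-- The factor `X` gains one degree of truncation, which drives the induction on `N`. -/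
lemma TruncBoundedBy.X_mul {a : ℝ} (ha : 0 ≤ a) {N : ℕ} {P : PowerSeries ℝ} {v : ℝ}
    (hP : TruncBoundedBy a N P v) : TruncBoundedBy a (N + 1) (PowerSeries.X * P) (a * v) := by
  refine ⟨coeff_mul_nonneg (TruncBoundedBy.X ha 0).1 hP.1, ?_⟩
  have h : truncValue (PowerSeries.X * P) a (N + 1) = a * truncValue P a N := by
    rw [truncValue, Finset.sum_range_succ', truncValue, Finset.mul_sum]
    simp only [PowerSeries.coeff_succ_X_mul, PowerSeries.coeff_zero_X_mul, zero_mul, add_zero]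
    exact Finset.sum_congr rfl fun n _ => by ring
  rw [h]
  exact mul_le_mul_of_nonneg_left hP.2 ha

lemma TruncBoundedBy.monomial {m : ℕ} {a : ℝ} (ha : 0 ≤ a) {b : Fin m → ℝ} {N : ℕ}
    {T : Fin m → PowerSeries ℝ} (hT : ∀ i, TruncBoundedBy a N (T i) (b i))
    {d : Fin (m + 1) →₀ ℕ} (hd : d 0 ≠ 0) :
    TruncBoundedBy a (N + 1)
      (d.prod fun k e => (Fin.cons PowerSeries.X T : Fin (m + 1) → PowerSeries ℝ) k ^ e)
      (d.prod fun k e => (Fin.cons a b : Fin (m + 1) → ℝ) k ^ e) := by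
  obtain ⟨e, he⟩ := Nat.exists_eq_succ_of_ne_zero hd
  rw [Finsupp.prod_fintype _ _ (by simp), Finsupp.prod_fintype _ _ (by simp),
    Fin.prod_univ_succ, Fin.prod_univ_succ]
  simp only [Fin.cons_zero, Fin.cons_succ, he, Nat.succ_eq_add_one, pow_succ']
  rw [mul_assoc, mul_assoc]
  exact (((TruncBoundedBy.X ha N).pow ha e).mul ha
    (TruncBoundedBy.prod ha _ fun i => (hT i).pow ha _)).X_mul ha

/-! ### Domination of the standard solution -/

lemma summand_nonneg {σ : Type*} {A : MvPowerSeries σ ℝ} (hA : ∀ n, 0 ≤ MvPowerSeries.coeff n A)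
    {c : σ → ℝ} (hc : ∀ k, 0 ≤ c k) (n : σ →₀ ℕ) : 0 ≤ summand A c n :=
  mul_nonneg (hA n) (Finset.prod_nonneg fun k _ => pow_nonneg (hc k) _)

lemma coeff_eq_zero_of_setZero {m : ℕ} {A : MvPowerSeries (Fin (m + 1)) ℝ}
    (hA : setZero {0} A = 0) {d : Fin (m + 1) →₀ ℕ} (hd : d 0 = 0) :
    MvPowerSeries.coeff d A = 0 := by
  have h := congrFun hA d
  rwa [setZero, Set.indicator_of_mem (by simpa using hd)] at h

/-- The truncations of the standard solution are bounded by any nonnegative solution. -/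
lemma IsStandardSolution.truncBoundedBy {m : ℕ} {G : System m} (hG : WellConditioned G)
    {T : Fin m → PowerSeries ℝ} (hT : IsStandardSolution G T) {a : ℝ} (ha : 0 ≤ a)
    {b : Fin m → ℝ} (hb : ∀ i, 0 ≤ b i)
    (hval : ∀ i, HasValue (G i) (Fin.cons a b : Fin (m + 1) → ℝ) (b i)) (N : ℕ) :
    ∀ i, TruncBoundedBy a N (T i) (b i) := by
  induction N with
  | zero => exact fun i => ⟨hT.nonneg i, by simpa [truncValue] using hb i⟩
  | succ N ih =>
    intro i
    refine ⟨hT.nonneg i, ?_⟩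
    set F : (Fin (m + 1) →₀ ℕ) → PowerSeries ℝ := fun d =>
      d.prod fun k e => (Fin.cons PowerSeries.X T : Fin (m + 1) → PowerSeries ℝ) k ^ e with hF
    have hsub : MvPowerSeries.HasSubst
        (Fin.cons PowerSeries.X T : Fin (m + 1) → PowerSeries ℝ) := by
      refine MvPowerSeries.hasSubst_of_constantCoeff_zero fun s => ?_
      refine Fin.cases ?_ (fun j => ?_) s
      · exact PowerSeries.constantCoeff_X
      · exact hT.constantCoeff j
    have hfin : ∀ n : ℕ, (fun d => MvPowerSeries.coeff d (G i) *
        PowerSeries.coeff n (F d)).HasFiniteSupport := fun n =>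
      MvPowerSeries.coeff_subst_finite hsub (G i) (Finsupp.single () n)
    have hcoeff : ∀ n : ℕ, PowerSeries.coeff n (T i) =
        ∑ᶠ d, MvPowerSeries.coeff d (G i) * PowerSeries.coeff n (F d) := fun n => by
      conv_lhs => rw [hT.eq_subst i]
      exact MvPowerSeries.coeff_subst hsub (G i) (Finsupp.single () n)
    -- Finitely many monomials of `G i` account for all coefficients of degree at most `N`, so the
    -- sums can be exchanged.
    set S : Finset (Fin (m + 1) →₀ ℕ) :=
      (Finset.range (N + 1)).biUnion fun n => (hfin n).toFinset with hS
    have hsum : ∀ n ∈ Finset.range (N + 1), PowerSeries.coeff n (T i) =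
        ∑ d ∈ S, MvPowerSeries.coeff d (G i) * PowerSeries.coeff n (F d) := by
      intro n hn
      rw [hcoeff n]
      refine finsum_eq_sum_of_support_subset _ fun d hd => ?_
      rw [hS, Finset.mem_coe, Finset.mem_biUnion]
      exact ⟨n, hn, (hfin n).mem_toFinset.2 hd⟩
    have hc : ∀ k, 0 ≤ (Fin.cons a b : Fin (m + 1) → ℝ) k := Fin.cases ha hb
    calc truncValue (T i) a (N + 1)
        = ∑ d ∈ S, MvPowerSeries.coeff d (G i) * truncValue (F d) a (N + 1) := by
          simp only [truncValue, Finset.mul_sum]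
          rw [Finset.sum_comm]
          refine Finset.sum_congr rfl fun n hn => ?_
          rw [hsum n hn, Finset.sum_mul]
          exact Finset.sum_congr rfl fun d _ => mul_assoc _ _ _
      _ ≤ ∑ d ∈ S, summand (G i) (Fin.cons a b : Fin (m + 1) → ℝ) d := by
          refine Finset.sum_le_sum fun d _ => ?_
          by_cases hd : d 0 = 0
          · simp [summand, coeff_eq_zero_of_setZero (hG.x_zero i) hd]
          · exact mul_le_mul_of_nonneg_left (TruncBoundedBy.monomial ha ih hd).2 (hG.nonneg i d)
      _ ≤ b i := sum_le_hasSum S (fun d _ => summand_nonneg (hG.nonneg i) hc d) (hval i)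

lemma ofReal_le_radius {P : PowerSeries ℝ} {a C : ℝ} (ha : 0 ≤ a)
    (hP : ∀ N, TruncBoundedBy a N P C) : ENNReal.ofReal a ≤ radius P := by
  refine FormalMultilinearSeries.le_radius_of_bound _ C fun n => ?_
  rw [FormalMultilinearSeries.ofScalars_norm, Real.coe_toNNReal a ha, Real.norm_eq_abs,
    abs_of_nonneg ((hP 0).1 n)]
  refine le_trans ?_ (hP (n + 1)).2
  rw [truncValue, Finset.sum_range_succ]
  exact le_add_of_nonneg_left (truncValue_nonneg (hP 0).1 ha n)

/-! ### Convexity through Bernoulli's inequality -/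

lemma one_add_sum_le_prod {ι : Type*} {f : ι → ℝ} (hf : ∀ i, 0 ≤ f i) (s : Finset ι) :
    1 + ∑ i ∈ s, f i ≤ ∏ i ∈ s, (1 + f i) := by
  classical
  induction s using Finset.induction_on with
  | empty => simp
  | insert i s hi ih =>
    rw [Finset.sum_insert hi, Finset.prod_insert hi]
    have h := mul_le_mul_of_nonneg_left ih (add_nonneg zero_le_one (hf i))
    nlinarith [mul_nonneg (hf i) (Finset.sum_nonneg fun j (_ : j ∈ s) => hf j)]

/-- The multiplicative form of Bernoulli's inequality for a monomial. -/
lemma one_add_sum_le_monomial {σ : Type*} [Fintype σ] {r : σ → ℝ} (hr : ∀ k, 0 ≤ r k)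
    (n : σ →₀ ℕ) : 1 + ∑ k, (n k : ℝ) * r k ≤ n.prod fun k e => (1 + r k) ^ e := by
  rw [Finsupp.prod_fintype _ _ (by simp)]
  calc 1 + ∑ k, (n k : ℝ) * r k ≤ ∏ k, (1 + (n k : ℝ) * r k) :=
        one_add_sum_le_prod (fun k => mul_nonneg (Nat.cast_nonneg _) (hr k)) _
    _ ≤ ∏ k, (1 + r k) ^ n k := by
        refine Finset.prod_le_prod (fun k _ => ?_) fun k _ => ?_
        · have := mul_nonneg (Nat.cast_nonneg (α := ℝ) (n k)) (hr k)
          linarith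
        · exact one_add_mul_le_pow (by linarith [hr k]) _

/-- The cross term `r j * r k` is what the linear bound omits; `j = k` is allowed. -/
lemma one_add_sum_lt_monomial {σ : Type*} [Fintype σ] {r : σ → ℝ} (hr : ∀ k, 0 ≤ r k)
    (n : σ →₀ ℕ) {j k : σ} (hj : 0 < r j) (hk : 0 < r k) :
    1 + ∑ l, ((n + Finsupp.single j 1 + Finsupp.single k 1 : σ →₀ ℕ) l : ℝ) * r l <
      (n + Finsupp.single j 1 + Finsupp.single k 1).prod fun l e => (1 + r l) ^ e := by
  classical
  have hn := one_add_sum_le_monomial hr n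
  have hs : 0 ≤ ∑ l, (n l : ℝ) * r l :=
    Finset.sum_nonneg fun l _ => mul_nonneg (Nat.cast_nonneg _) (hr l)
  rw [Finsupp.prod_add_index' (by simp) (by simp [pow_add]),
    Finsupp.prod_add_index' (by simp) (by simp [pow_add]),
    Finsupp.prod_single_index (by simp), Finsupp.prod_single_index (by simp), pow_one, pow_one]
  have hL : ∑ l, ((n + Finsupp.single j 1 + Finsupp.single k 1 : σ →₀ ℕ) l : ℝ) * r l =
      ∑ l, (n l : ℝ) * r l + r j + r k := by
    simp [add_mul, Finset.sum_add_distrib, Finsupp.single_apply]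
  rw [hL]
  have h1 := mul_le_mul_of_nonneg_right hn (mul_pos (add_pos one_pos hj) (add_pos one_pos hk)).le
  nlinarith [mul_pos hj hk, mul_nonneg hs hj.le, mul_nonneg hs hk.le,
    mul_nonneg hs (mul_pos hj hk).le]

/-- The Euler operator `c_k ∂_k` multiplies each term by its exponent of `k`; terms outside the
shifted index set have exponent zero. -/
lemma hasSum_mul_summand {σ : Type*} {A : MvPowerSeries σ ℝ} {c : σ → ℝ} {k : σ} {v : ℝ}
    (h : HasValue (MvPowerSeries.pderiv ℝ k A) c v) :
    HasSum (fun n : σ →₀ ℕ => (n k : ℝ) * summand A c n) (c k * v) := by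
  classical
  have hinj : Function.Injective fun n : σ →₀ ℕ => n + Finsupp.single k 1 :=
    add_left_injective _
  refine (hinj.hasSum_iff fun n hn => ?_).1 ?_
  · have : n k = 0 := by
      by_contra h0
      refine hn ⟨n - Finsupp.single k 1, tsub_add_cancel_of_le ?_⟩
      rw [Finsupp.single_le_iff]
      omega
    simp [this]
  · refine (HasSum.mul_left (c k) h).congr_fun fun n => ?_
    change ((n + Finsupp.single k 1 : σ →₀ ℕ) k : ℝ) * summand A c (n + Finsupp.single k 1) = _
    rw [summand, summand, MvPowerSeries.coeff_pderiv, Finsupp.prod_add_index' (by simp) (by simp [pow_add]),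
      Finsupp.prod_single_index (by simp)]
    simp
    ring

/-- Scaling the point multiplies each term by the corresponding monomial in the scaling factors. -/
lemma summand_mul {σ : Type*} (A : MvPowerSeries σ ℝ) (c r : σ → ℝ) (n : σ →₀ ℕ) :
    summand A (fun k => c k * (1 + r k)) n =
      summand A c n * n.prod fun k e => (1 + r k) ^ e := by
  simp only [summand, mul_pow, Finsupp.prod_mul, mul_assoc]

section Convexity

variable {m : ℕ} {A : MvPowerSeries (Fin (m + 1)) ℝ} {a : ℝ} {τ b D : Fin m → ℝ} {u v : ℝ}

/-- With relative increments as scaling factors, tangent and series can be compared term by term at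
`(a, τ)`. -/
lemma cons_eq_mul (hτ : ∀ j, 0 < τ j) : (Fin.cons a b : Fin (m + 1) → ℝ) = fun k =>
    (Fin.cons a τ : Fin (m + 1) → ℝ) k *
      (1 + (Fin.cons 0 fun j => (b j - τ j) / τ j : Fin (m + 1) → ℝ) k) := by
  funext k
  refine Fin.cases (by simp) (fun j => ?_) k
  have := (hτ j).ne'
  simp only [Fin.cons_succ]
  field_simp
  ring

lemma hasSum_linearization (hτ : ∀ j, 0 < τ j)
    (hv : HasValue A (Fin.cons a τ : Fin (m + 1) → ℝ) v)
    (hD : ∀ j, HasValue (MvPowerSeries.pderiv ℝ (Fin.succ j) A)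
      (Fin.cons a τ : Fin (m + 1) → ℝ) (D j)) :
    HasSum (fun n => summand A (Fin.cons a τ : Fin (m + 1) → ℝ) n *
      (1 + ∑ k, (n k : ℝ) * (Fin.cons 0 fun j => (b j - τ j) / τ j : Fin (m + 1) → ℝ) k))
      (v + ∑ j, D j * (b j - τ j)) := by
  have h := hv.add (hasSum_sum (s := Finset.univ) fun j _ =>
    (hasSum_mul_summand (hD j)).mul_right ((b j - τ j) / τ j))
  convert h using 2 with n
  · rw [Fin.sum_univ_succ]
    simp only [Fin.cons_zero, Fin.cons_succ, mul_zero, zero_add, mul_add, mul_one,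
      Finset.mul_sum, add_right_inj]
    exact Finset.sum_congr rfl fun j _ => by ring
  · refine Finset.sum_congr rfl fun j _ => ?_
    have := (hτ j).ne'
    simp only [Fin.cons_succ]
    field_simp

lemma cons_div_nonneg (hτ : ∀ j, 0 < τ j) (hb : ∀ j, τ j ≤ b j) (k : Fin (m + 1)) :
    0 ≤ (Fin.cons 0 fun j => (b j - τ j) / τ j : Fin (m + 1) → ℝ) k :=
  Fin.cases le_rfl (fun j => div_nonneg (sub_nonneg.2 (hb j)) (hτ j).le) k

/-- A power series with nonnegative coefficients lies above its tangent in the `y` variables. -/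
lemma linearization_le (hA : ∀ n, 0 ≤ MvPowerSeries.coeff n A) (ha : 0 < a)
    (hτ : ∀ j, 0 < τ j) (hb : ∀ j, τ j ≤ b j)
    (hv : HasValue A (Fin.cons a τ : Fin (m + 1) → ℝ) v)
    (hD : ∀ j, HasValue (MvPowerSeries.pderiv ℝ (Fin.succ j) A)
      (Fin.cons a τ : Fin (m + 1) → ℝ) (D j))
    (hu : HasValue A (Fin.cons a b : Fin (m + 1) → ℝ) u) :
    v + ∑ j, D j * (b j - τ j) ≤ u := by
  refine hasSum_le (fun n => ?_) (hasSum_linearization hτ hv hD) hu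
  rw [cons_eq_mul (b := b) hτ, summand_mul]
  exact mul_le_mul_of_nonneg_left (one_add_sum_le_monomial (cons_div_nonneg hτ hb) n)
    (summand_nonneg hA (Fin.cases ha.le fun j => (hτ j).le) n)

lemma linearization_lt (hA : ∀ n, 0 ≤ MvPowerSeries.coeff n A) (ha : 0 < a)
    (hτ : ∀ j, 0 < τ j) (hb : ∀ j, τ j < b j)
    (hv : HasValue A (Fin.cons a τ : Fin (m + 1) → ℝ) v)
    (hD : ∀ j, HasValue (MvPowerSeries.pderiv ℝ (Fin.succ j) A)
      (Fin.cons a τ : Fin (m + 1) → ℝ) (D j))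
    (hu : HasValue A (Fin.cons a b : Fin (m + 1) → ℝ) u) {j k : Fin m}
    (hjk : MvPowerSeries.pderiv ℝ j.succ (MvPowerSeries.pderiv ℝ k.succ A) ≠ 0) :
    v + ∑ j, D j * (b j - τ j) < u := by
  have hc : ∀ l, 0 < (Fin.cons a τ : Fin (m + 1) → ℝ) l := Fin.cases ha hτ
  have hr := cons_div_nonneg hτ fun j => (hb j).le
  have hrpos : ∀ l : Fin m,
      0 < (Fin.cons 0 fun j => (b j - τ j) / τ j : Fin (m + 1) → ℝ) l.succ := fun l => by
    simpa using div_pos (sub_pos.2 (hb l)) (hτ l)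
  obtain ⟨n, hn⟩ : ∃ n, MvPowerSeries.coeff n
      (MvPowerSeries.pderiv ℝ j.succ (MvPowerSeries.pderiv ℝ k.succ A)) ≠ 0 := by
    by_contra! h
    exact hjk (MvPowerSeries.ext fun n => by simpa using h n)
  rw [MvPowerSeries.coeff_pderiv, MvPowerSeries.coeff_pderiv] at hn
  have hpos : 0 < summand A (Fin.cons a τ : Fin (m + 1) → ℝ)
      (n + Finsupp.single j.succ 1 + Finsupp.single k.succ 1) :=
    mul_pos ((hA _).lt_of_ne' (left_ne_zero_of_mul (left_ne_zero_of_mul hn)))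
      (Finset.prod_pos fun l _ => pow_pos (hc l) _)
  refine hasSum_lt (i := n + Finsupp.single j.succ 1 + Finsupp.single k.succ 1)
    (fun n => ?_) ?_ (hasSum_linearization hτ hv hD) hu
  · rw [cons_eq_mul (b := b) hτ, summand_mul]
    exact mul_le_mul_of_nonneg_left (one_add_sum_le_monomial hr n)
      (summand_nonneg hA (fun l => (hc l).le) n)
  · rw [cons_eq_mul (b := b) hτ, summand_mul]
    exact mul_lt_mul_of_pos_left (one_add_sum_lt_monomial hr n (hrpos j) (hrpos k)) hpos

end Convexity

/-! ### Positivity and irreducible matrices -/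

/-- The value of a nonzero power series with nonnegative coefficients at a positive point is
positive. -/
lemma HasValue.pos {σ : Type*} {A : MvPowerSeries σ ℝ} (hA : ∀ n, 0 ≤ MvPowerSeries.coeff n A)
    (hA0 : A ≠ 0) {c : σ → ℝ} (hc : ∀ k, 0 < c k) {v : ℝ} (hv : HasValue A c v) : 0 < v := by
  obtain ⟨n, hn⟩ : ∃ n, MvPowerSeries.coeff n A ≠ 0 := by
    by_contra! h
    exact hA0 (MvPowerSeries.ext fun n => by simpa using h n)
  refine lt_of_lt_of_le (mul_pos ((hA n).lt_of_ne' hn)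
    (Finset.prod_pos (s := n.support) fun l _ => pow_pos (hc l) (n l))) ?_
  exact le_hasSum hv n fun l _ => summand_nonneg hA (fun k => (hc k).le) l

lemma HasValue.nonneg {σ : Type*} {A : MvPowerSeries σ ℝ}
    (hA : ∀ n, 0 ≤ MvPowerSeries.coeff n A)
    {c : σ → ℝ} (hc : ∀ k, 0 ≤ c k) {v : ℝ} (hv : HasValue A c v) : 0 ≤ v :=
  HasSum.nonneg (summand_nonneg hA hc) hv

section Irreducible

open Matrix

variable {ι : Type*} {M : Matrix ι ι ℝ}

lemma IrreducibleMatrix.transpose (h : IrreducibleMatrix M) : IrreducibleMatrix Mᵀ :=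
  fun i j => Relation.ReflTransGen.swap _ _ (h j i)

variable [Fintype ι]

/-- A nonzero nonnegative vector `v ≥ M v` is positive if `M` is nonnegative and irreducible. -/
lemma pos_of_mulVec_le (hM : ∀ i j, 0 ≤ M i j) (hirr : IrreducibleMatrix M) {v : ι → ℝ}
    (hv : 0 ≤ v) (hv0 : v ≠ 0) (hle : M *ᵥ v ≤ v) (i : ι) : 0 < v i := by
  obtain ⟨j, hj⟩ := Function.ne_iff.1 hv0
  have hj : 0 < v j := (hv j).lt_of_ne' hj
  have step : ∀ k l, M k l ≠ 0 → 0 < v l → 0 < v k := fun k l hkl hl =>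
    calc 0 < M k l * v l := mul_pos ((hM k l).lt_of_ne' hkl) hl
      _ ≤ (M *ᵥ v) k := Finset.single_le_sum (f := fun l => M k l * v l)
          (fun l _ => mul_nonneg (hM k l) (hv l)) (Finset.mem_univ l)
      _ ≤ v k := hle k
  induction hirr i j using Relation.ReflTransGen.head_induction_on with
  | refl => exact hj
  | head h _ ih => exact step _ _ h ih

/-- If `1` is an eigenvalue of a nonnegative irreducible matrix `M`, then a nonzero nonnegative
vector `v ≥ M v` is positive and fixed by `M`. -/
lemma mulVec_eq_of_le [DecidableEq ι] (hM : ∀ i j, 0 ≤ M i j) (hirr : IrreducibleMatrix M)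
    (hdet : (1 - M).det = 0) {v : ι → ℝ} (hv : 0 ≤ v) (hv0 : v ≠ 0) (hle : M *ᵥ v ≤ v) :
    (∀ i, 0 < v i) ∧ M *ᵥ v = v := by
  have hvpos := pos_of_mulVec_le hM hirr hv hv0 hle
  refine ⟨hvpos, ?_⟩
  -- Pair `v` with `u = |w|`, where `w` is a left eigenvector. Then `u·v ≤ uM·v = u·Mv ≤ u·v`, so
  -- equality holds throughout; `v > 0` forces `uM = u`, hence `u > 0`, which in turn forces `Mv =
  -- v`.
  obtain ⟨w, hw0, hw⟩ := Matrix.exists_vecMul_eq_zero_iff.2 hdet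
  rw [Matrix.vecMul_sub, Matrix.vecMul_one, sub_eq_zero] at hw
  set u : ι → ℝ := fun i => |w i| with hu
  have hu_le : u ≤ u ᵥ* M := fun j =>
    calc |w j| = |∑ i, w i * M i j| := congrArg abs (congrFun hw j)
      _ ≤ ∑ i, |w i * M i j| := Finset.abs_sum_le_sum_abs _ _
      _ = ∑ i, |w i| * M i j :=
        Finset.sum_congr rfl fun i _ => by rw [abs_mul, abs_of_nonneg (hM i j)]
  have hu_nonneg : 0 ≤ u := fun i => abs_nonneg _
  have hu0 : u ≠ 0 := fun h => hw0 (funext fun i => abs_eq_zero.1 (congrFun h i))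
  have h1 : u ⬝ᵥ (M *ᵥ v) ≤ u ⬝ᵥ v := dotProduct_le_dotProduct_of_nonneg_left hle hu_nonneg
  have h2 : u ⬝ᵥ v ≤ u ⬝ᵥ (M *ᵥ v) := by
    rw [Matrix.dotProduct_mulVec]
    exact dotProduct_le_dotProduct_of_nonneg_right hu_le hv
  have huM : u ᵥ* M = u := by
    have h3 : ∑ j, ((u ᵥ* M) j - u j) * v j = 0 := by
      simp only [sub_mul, Finset.sum_sub_distrib]
      have h4 := le_antisymm h1 h2
      rw [Matrix.dotProduct_mulVec] at h4
      exact sub_eq_zero.2 h4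
    rw [Finset.sum_eq_zero_iff_of_nonneg
      fun j _ => mul_nonneg (sub_nonneg.2 (hu_le j)) (hv j)] at h3
    funext j
    exact sub_eq_zero.1 ((mul_eq_zero.1 (h3 j (Finset.mem_univ j))).resolve_right (hvpos j).ne')
  have hupos : ∀ i, 0 < u i := pos_of_mulVec_le (M := Mᵀ) (fun i j => hM j i) hirr.transpose
    hu_nonneg hu0 (by rw [Matrix.mulVec_transpose, huM])
  have h3 : ∑ j, u j * (v j - (M *ᵥ v) j) = 0 := by
    simp only [mul_sub, Finset.sum_sub_distrib]
    exact sub_eq_zero.2 (le_antisymm h2 h1)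
  rw [Finset.sum_eq_zero_iff_of_nonneg
    fun j _ => mul_nonneg (hu_nonneg j) (sub_nonneg.2 (hle j))] at h3
  funext j
  exact (sub_eq_zero.1
    ((mul_eq_zero.1 (h3 j (Finset.mem_univ j))).resolve_left (hupos j).ne')).symm

end Irreducible

/-! ### Rigidity and conclusion -/

/-- A characteristic point is the only solution above it with the same first coordinate. -/
lemma IsCharacteristicPoint.eq_of_le {m : ℕ} {G : System m} (hG : WellConditioned G) {a : ℝ}
    {τ b : Fin m → ℝ} (hτ : IsCharacteristicPoint G a τ) (hle : ∀ i, τ i ≤ b i)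
    (hb : ∀ i, HasValue (G i) (Fin.cons a b : Fin (m + 1) → ℝ) (b i)) : b = τ := by
  obtain ⟨ha, hτpos, hτval, J, hJ, hdet⟩ := hτ
  by_contra hne
  have hc : ∀ k, 0 < (Fin.cons a τ : Fin (m + 1) → ℝ) k := Fin.cases ha hτpos
  have hcoeff : ∀ i j n, 0 ≤ MvPowerSeries.coeff n (jacobian G i j) := fun i j n => by
    simp only [jacobian, Matrix.of_apply, MvPowerSeries.coeff_pderiv]
    exact mul_nonneg (hG.nonneg i _) (by positivity)
  have hJ0 : ∀ i j, 0 ≤ J i j := fun i j =>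
    HasValue.nonneg (hcoeff i j) (fun k => (hc k).le) (hJ i j)
  -- Nonzero formal entries have positive values at a positive point, so no edge is lost.
  have hirr : IrreducibleMatrix J := fun i j =>
    Relation.ReflTransGen.mono
      (fun k l hkl => (HasValue.pos (hcoeff k l) hkl hc (hJ k l)).ne') i j (hG.irreducible i j)
  have hlin : ∀ i, (J.mulVec (b - τ)) i ≤ (b - τ) i := fun i => by
    have h := linearization_le (hG.nonneg i) ha hτpos hle (hτval i) (hJ i) (hb i)
    change ∑ j, J i j * (b j - τ j) ≤ b i - τ i
    linarith
  obtain ⟨hpos, heq⟩ := mulVec_eq_of_le hJ0 hirr hdet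
    (v := b - τ) (fun i => sub_nonneg.2 (hle i)) (sub_ne_zero.2 hne) hlin
  obtain ⟨i, j, k, hjk⟩ := hG.nonlinear
  have h := linearization_lt (hG.nonneg i) ha hτpos (fun l => sub_pos.1 (hpos l)) (hτval i)
    (hJ i) (hb i) hjk
  have h' : ∑ j, J i j * (b j - τ j) = b i - τ i := congrFun heq i
  linarith

end CharSystem

theorem mainTheorem3 {m : ℕ} (G : CharSystem.System m) (hG : CharSystem.WellConditioned G)
    (ρ : ℝ) (τ : Fin m → ℝ) (hext : CharSystem.IsExtremePoint G ρ τ)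
    (hchar : CharSystem.IsCharacteristicPoint G ρ τ) :
    IsGreatest {a : ℝ | ∃ b : Fin m → ℝ, CharSystem.IsCharacteristicPoint G a b} ρ ∧
      ∀ b : Fin m → ℝ, CharSystem.IsCharacteristicPoint G ρ b → b = τ := by
  obtain ⟨hρ, T, hT, hTρ⟩ := hext
  refine ⟨⟨⟨τ, hchar⟩, ?_⟩, ?_⟩
  · rintro a ⟨b, ha, hb, hval, -⟩
    -- Only an index is needed here, to have some `T i` whose radius is `ρ`.
    obtain ⟨i, -⟩ := hG.nonlinear
    have h := CharSystem.ofReal_le_radius ha.le fun N =>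
      hT.truncBoundedBy hG ha.le (fun j => (hb j).le) hval N i
    rw [(hTρ i).1] at h
    exact (ENNReal.ofReal_le_ofReal_iff hρ).1 h
  · rintro b ⟨-, hb, hval, -⟩
    refine hchar.eq_of_le hG (fun i => ?_) hval
    exact le_of_tendsto' (hTρ i).2.tendsto_sum_nat fun N =>
      (hT.truncBoundedBy hG hρ (fun j => (hb j).le) hval N i).2
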